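/- For an integer $n\ge 0$ and a real number $b>0$ let $\mathbf F(n,b)$ be the Fubini--Study space, that is, the complex projective space $\mathbb{CP}^n$ with homogeneous coordinates $[\xi_0:\dots:\xi_n]$ and with the Kähler metric which, in each affine chart $w=(\xi_j/\xi_i)_{j\neq i}$ on $\{\xi_i\ne 0\}$, has the Kähler potential $\frac1b\log(1+|w|^2)$ (equivalently $\frac1b\log(1+b|Z|^2)$ in the coordinates $Z=w/\sqrt b$). Two Kähler manifolds $M$ and $N$ are called relatives if they share a common Kähler submanifold of positive dimension, i.e. if there are a nonempty complex manifold $Z$ of dimension at least $1$ and holomorphic immersions $f:Z\to M$ and $g:Z\to N$ that induce the same metric on $Z$. Let $a,b>0$ be real numbers and let $s,r$ be coprime positive integers with $sa=rb$ (so that $a/b\in\mathbb Q$). If $\mathbf F(n,b)$ and $\mathbf F(m,a)$ are relatives, then $$r+1\le\binom{s+m}{s}\qquad\text{and}\qquad s+1\le\binom{r+n}{r}.$$ -/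

import Mathlib

open scoped Manifold ContDiff LinearAlgebra.Projectivization

noncomputable section

/-- The underlying space of `F(n,b)`, `b > 0`: complex projective `n`-space, with homogeneous
coordinates `[ξ₀ : … : ξₙ]`. -/
def FubiniStudy (n : ℕ) (_b : ℝ) : Type := ℙ ℂ (Fin (n + 1) → ℂ)

namespace FubiniStudy

variable {n : ℕ} {b : ℝ}

/-- The point `[ξ₀ : … : ξₙ]`. -/
def proj (n : ℕ) (b : ℝ) (v : {v : Fin (n + 1) → ℂ // v ≠ 0}) : FubiniStudy n b :=
  Projectivization.mk' ℂ v

/-- The quotient topology. -/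
instance : TopologicalSpace (FubiniStudy n b) :=
  TopologicalSpace.coinduced (proj n b) inferInstance

theorem isQuotientMap_proj : Topology.IsQuotientMap (proj n b) where
  surjective x := by
    induction x using Projectivization.ind with
    | h v hv => exact ⟨⟨v, hv⟩, rfl⟩
  eq_coinduced := rfl

/-- `ξᵢ ≠ 0`. -/
def CoordNeZero (i : Fin (n + 1)) (x : FubiniStudy n b) : Prop :=
  Projectivization.lift (fun v : {v : Fin (n + 1) → ℂ // v ≠ 0} => v.1 i ≠ 0)
    (by
      rintro ⟨u, hu⟩ ⟨v, hv⟩ t h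
      have h' : u = t • v := h
      subst h'
      have ht : t ≠ 0 := by
        rintro rfl
        simp at hu
      simp [ht]) x

/-- The inhomogeneous coordinates `(ξ_j / ξᵢ)_{j ≠ i}`. -/
def affineCoord (i : Fin (n + 1)) (x : FubiniStudy n b) : EuclideanSpace ℂ (Fin n) :=
  Projectivization.lift (fun v : {v : Fin (n + 1) → ℂ // v ≠ 0} =>
      WithLp.toLp 2 (fun j : Fin n => v.1 (i.succAbove j) / v.1 i))
    (by
      rintro ⟨u, hu⟩ ⟨v, hv⟩ t h
      have h' : u = t • v := h
      subst h'
      have ht : t ≠ 0 := by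
        rintro rfl
        simp at hu
      simp [mul_div_mul_left _ _ ht]) x

/-- Homogeneous coordinates with `ξᵢ = 1` and the other entries given by `w`. -/
def homog (i : Fin (n + 1)) (w : EuclideanSpace ℂ (Fin n)) : {v : Fin (n + 1) → ℂ // v ≠ 0} :=
  ⟨i.insertNth (1 : ℂ) (fun j => w j), fun h => by simpa using congrFun h i⟩

theorem continuous_homog (i : Fin (n + 1)) : Continuous (homog i) := by
  refine Continuous.subtype_mk (continuous_pi fun l => ?_) _
  induction l using Fin.succAboveCases i with
  | x => simpa using continuous_const
  | p j => simp only [Fin.insertNth_apply_succAbove]; fun_prop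

theorem isOpen_coordNeZero (i : Fin (n + 1)) :
    IsOpen {x : FubiniStudy n b | CoordNeZero i x} := by
  rw [← isQuotientMap_proj.isOpen_preimage]
  have h : Continuous fun v : {v : Fin (n + 1) → ℂ // v ≠ 0} => v.1 i :=
    (continuous_apply i).comp continuous_subtype_val
  exact isOpen_ne_fun h continuous_const

/-- The affine chart on `{ξᵢ ≠ 0}`. -/
def affineChart (b : ℝ) (i : Fin (n + 1)) :
    OpenPartialHomeomorph (FubiniStudy n b) (EuclideanSpace ℂ (Fin n)) where
  toFun := affineCoord i
  invFun w := proj n b (homog i w)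
  source := {x | CoordNeZero i x}
  target := Set.univ
  map_source' _ _ := Set.mem_univ _
  map_target' w _ := by
    change (homog i w).1 i ≠ 0
    simp [homog]
  left_inv' x hx := by
    obtain ⟨v, rfl⟩ := isQuotientMap_proj.surjective x
    have hv : v.1 i ≠ 0 := hx
    refine (Projectivization.mk_eq_mk_iff' ℂ _ _ (homog i _).2 v.2).2 ⟨(v.1 i)⁻¹, ?_⟩
    funext l
    induction l using Fin.succAboveCases i with
    | x => simp [homog, hv]
    | p j =>
      simp only [homog, Fin.insertNth_apply_succAbove, Pi.smul_apply, smul_eq_mul]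
      change _ = v.1 (i.succAbove j) / v.1 i
      rw [div_eq_inv_mul]
  right_inv' w _ := by
    ext j
    change (homog i w).1 (i.succAbove j) / (homog i w).1 i = w j
    simp [homog]
  open_source := isOpen_coordNeZero i
  open_target := isOpen_univ
  continuousOn_toFun := by
    rw [isQuotientMap_proj.continuousOn_isOpen_iff (isOpen_coordNeZero i)]
    refine (PiLp.continuous_toLp 2 _).comp_continuousOn (continuousOn_pi.2 fun j => ?_)
    exact ContinuousOn.div ((continuous_apply _).comp continuous_subtype_val).continuousOn
      ((continuous_apply _).comp continuous_subtype_val).continuousOn fun v hv => hv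
  continuousOn_invFun :=
    (isQuotientMap_proj.continuous.comp (continuous_homog i)).continuousOn

theorem exists_coordNeZero (x : FubiniStudy n b) : ∃ i, CoordNeZero i x := by
  obtain ⟨v, rfl⟩ := isQuotientMap_proj.surjective x
  exact Function.ne_iff.1 v.2

/-- The `n + 1` affine charts form the atlas. -/
instance : ChartedSpace (EuclideanSpace ℂ (Fin n)) (FubiniStudy n b) where
  atlas := Set.range (affineChart b)
  chartAt x := affineChart b (exists_coordNeZero x).choose
  mem_chart_source x := (exists_coordNeZero x).choose_spec
  chart_mem_atlas _ := Set.mem_range_self _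

/-- The transition maps are holomorphic. -/
instance : IsManifold 𝓘(ℂ, EuclideanSpace ℂ (Fin n)) ω (FubiniStudy n b) := by
  refine isManifold_of_contDiffOn _ _ _ ?_
  rintro _ _ ⟨i, rfl⟩ ⟨j, rfl⟩
  have key : ∀ l : Fin (n + 1), ContDiff ℂ ω
      fun w : EuclideanSpace ℂ (Fin n) => (homog i w).1 l := by
    intro l
    induction l using Fin.succAboveCases i with
    | x => simpa [homog] using contDiff_const
    | p k => simp only [homog, Fin.insertNth_apply_succAbove]; fun_prop
  rw [contDiffOn_euclidean]
  intro k
  refine ContDiffOn.congr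
    (f := fun w => (homog i w).1 (j.succAbove k) / (homog i w).1 j) ?_ fun w _ => rfl
  refine (key _).contDiffOn.div (key _).contDiffOn fun w hw => ?_
  have hw' : CoordNeZero j (proj n b (homog i w)) := by
    simpa [affineChart] using hw
  exact hw'

end FubiniStudy

section Wirtinger

variable {E : Type*} [NormedAddCommGroup E] [NormedSpace ℂ E]

/-- The `(1,0)`-derivative `∂ᵤφ = ½ (Dᵤφ - i D_{iu}φ)`. -/
def dHol (φ : E → ℂ) (w u : E) : ℂ :=
  (fderiv ℝ φ w u - Complex.I * fderiv ℝ φ w (Complex.I • u)) / 2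

/-- The `(0,1)`-derivative `∂̄ᵥφ = ½ (Dᵥφ + i D_{iv}φ)`. -/
def dBar (φ : E → ℂ) (w v : E) : ℂ :=
  (fderiv ℝ φ w v + Complex.I * fderiv ℝ φ w (Complex.I • v)) / 2

/-- The complex Hessian `∑ⱼₖ (∂²φ / ∂wⱼ ∂w̄ₖ) uⱼ v̄ₖ`, i.e. the Hermitian form whose associated
`(1,1)`-form is `√-1 ∂∂̄φ`. -/
def complexHessian (φ : E → ℂ) (w u v : E) : ℂ :=
  dHol (fun z => dBar φ z v) w u

end Wirtinger

/-- The Hermitian metric of `F(n,b)`, `b > 0`: in each affine chart it has the Kähler potential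
`(1/b) log (1 + |w|²)`, i.e. `(1/b) log (1 + b |Z|²)` in the rescaled coordinates `Z = w / √b`.
Tangent vectors at `x` are represented in the preferred chart at `x`, which is an affine chart. On
overlaps the potentials differ by the pluriharmonic function `(1/b) log |ξᵢ / ξⱼ|²`, so the
forms in the different charts are the same. -/
def fubiniStudyMetric (n : ℕ) (b : ℝ) (x : FubiniStudy n b)
    (u v : TangentSpace 𝓘(ℂ, EuclideanSpace ℂ (Fin n)) x) : ℂ :=
  complexHessian (E := EuclideanSpace ℂ (Fin n))
    (fun w => ((1 / b * Real.log (1 + ‖w‖ ^ 2) : ℝ) : ℂ))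
    (chartAt (EuclideanSpace ℂ (Fin n)) x x) u v

/-- A holomorphic immersion of complex manifolds. -/
def IsHolomorphicImmersion {d n : ℕ}
    {Z : Type} [TopologicalSpace Z] [ChartedSpace (EuclideanSpace ℂ (Fin d)) Z]
    {M : Type} [TopologicalSpace M] [ChartedSpace (EuclideanSpace ℂ (Fin n)) M]
    (f : Z → M) : Prop :=
  MDifferentiable 𝓘(ℂ, EuclideanSpace ℂ (Fin d)) 𝓘(ℂ, EuclideanSpace ℂ (Fin n)) f ∧
    ∀ z, Function.Injective
      (mfderiv 𝓘(ℂ, EuclideanSpace ℂ (Fin d)) 𝓘(ℂ, EuclideanSpace ℂ (Fin n)) f z)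

/-- Two complex manifolds `M`, `N` with Hermitian metrics `hM`, `hN` are relatives when they share
a common complex submanifold of positive dimension with the same induced metric: there are a
nonempty complex manifold `Z` of dimension `d ≥ 1` and holomorphic immersions `f : Z → M`,
`g : Z → N` with `f^* hM = g^* hN`. -/
def AreRelatives {n m : ℕ}
    (M : Type) [TopologicalSpace M] [ChartedSpace (EuclideanSpace ℂ (Fin n)) M]
    (hM : ∀ x : M, TangentSpace 𝓘(ℂ, EuclideanSpace ℂ (Fin n)) x →
      TangentSpace 𝓘(ℂ, EuclideanSpace ℂ (Fin n)) x → ℂ)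
    (N : Type) [TopologicalSpace N] [ChartedSpace (EuclideanSpace ℂ (Fin m)) N]
    (hN : ∀ y : N, TangentSpace 𝓘(ℂ, EuclideanSpace ℂ (Fin m)) y →
      TangentSpace 𝓘(ℂ, EuclideanSpace ℂ (Fin m)) y → ℂ) : Prop :=
  ∃ (d : ℕ) (Z : Type) (_ : TopologicalSpace Z)
    (_ : ChartedSpace (EuclideanSpace ℂ (Fin d)) Z) (f : Z → M) (g : Z → N),
    1 ≤ d ∧ Nonempty Z ∧ T2Space Z ∧ SecondCountableTopology Z ∧
    IsManifold 𝓘(ℂ, EuclideanSpace ℂ (Fin d)) ω Z ∧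
    IsHolomorphicImmersion (d := d) (n := n) f ∧ IsHolomorphicImmersion (d := d) (n := m) g ∧
    ∀ (z : Z) (u v : TangentSpace 𝓘(ℂ, EuclideanSpace ℂ (Fin d)) z),
      hM (f z)
        (mfderiv 𝓘(ℂ, EuclideanSpace ℂ (Fin d)) 𝓘(ℂ, EuclideanSpace ℂ (Fin n)) f z u)
        (mfderiv 𝓘(ℂ, EuclideanSpace ℂ (Fin d)) 𝓘(ℂ, EuclideanSpace ℂ (Fin n)) f z v) =
      hN (g z)
        (mfderiv 𝓘(ℂ, EuclideanSpace ℂ (Fin d)) 𝓘(ℂ, EuclideanSpace ℂ (Fin m)) g z u)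
        (mfderiv 𝓘(ℂ, EuclideanSpace ℂ (Fin d)) 𝓘(ℂ, EuclideanSpace ℂ (Fin m)) g z v)

end

/-! Restrict both immersions to a holomorphic disc in the common submanifold and lift the resulting
projective curves to nonvanishing holomorphic maps `V`, `W` into `ℂ^(n+1)`, `ℂ^(m+1)`. Since `s * a
= r * b`, equality of the metrics reads `r ∂∂̄ log ‖V‖² = s ∂∂̄ log ‖W‖²`. On a disc this integrates
to `‖V‖^(2r) = |h|² ‖W‖^(2s)` with `h` holomorphic without zeros
(`exists_norm_pow_eq_of_fsForm_eq`), and polarization gives `⟪V w, V z⟫^r = h z * conj (h w) * ⟪W w,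
W z⟫^s` (`inner_pow_eq_of_norm_pow_eq`).

Evaluate this kernel at `s + 1` points. The left side is a Gram matrix of vectors in the `r`-th
symmetric power of `ℂ^(n+1)`, so its rank is at most `(r + n).choose r`. On the right, if the points
separate some affine coordinate of `W`, a Vandermonde argument gives rank `s + 1`. Such points exist
because the second curve is immersed at the centre. Exchanging the two spaces yields the other
inequality. -/

open scoped InnerProductSpace ComplexConjugate

open Metric Filter Topology

/-! ### Ranks of entrywise powers of Gram matrices -/

section GramMatrix

open scoped ComplexOrder

/-- The multinomial theorem factors the matrix through the degree `r` monomials in the coordinates,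
which are indexed by `Sym ι r`. -/
theorem rank_of_inner_pow_le {ι κ : Type*} [Fintype ι] [Fintype κ]
    (x : κ → EuclideanSpace ℂ ι) (r : ℕ) :
    (Matrix.of fun i j : κ => inner ℂ (x j) (x i) ^ r).rank ≤
      (Fintype.card ι + r - 1).choose r := by
  classical
  have key : (Matrix.of fun i j : κ => inner ℂ (x j) (x i) ^ r) =
      (Matrix.of fun (i : κ) (k : Sym ι r) => ((k.val.countPerms : ℂ) *
        (k.val.map fun l => x i l).prod)) *
      (Matrix.of fun (k : Sym ι r) (j : κ) => (k.val.map fun l => conj (x j l)).prod) := by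
    ext i j
    simp only [Matrix.of_apply, Matrix.mul_apply, PiLp.inner_apply, RCLike.inner_apply]
    rw [Finset.sum_pow, Finset.sym_univ]
    refine Finset.sum_congr rfl fun k _ => ?_
    rw [Multiset.prod_map_mul, mul_assoc]
  rw [key, ← Sym.card_sym_eq_choose]
  exact (Matrix.rank_mul_le_left _ _).trans (Matrix.rank_le_card_width _)

/-- This is the Gram matrix of the vectors `c i • (y i)^{⊗ s}`, so full rank means that they are
linearly independent. Among their coordinates are the powers `c i * (y i l)^e` for `e ≤ s`, which
form a Vandermonde system with distinct nodes. -/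
theorem rank_of_mul_inner_pow {ι : Type*} [Fintype ι] {s : ℕ}
    (y : Fin (s + 1) → EuclideanSpace ℂ ι) (c : Fin (s + 1) → ℂ) (hc : ∀ i, c i ≠ 0)
    (k l : ι) (hk : ∀ i, y i k = 1) (hl : Function.Injective fun i => y i l) :
    (Matrix.of fun i j => c i * conj (c j) * inner ℂ (y j) (y i) ^ s).rank = s + 1 := by
  classical
  set Φ : Matrix (Fin (s + 1)) (Fin s → ι) ℂ := Matrix.of fun i p => c i * ∏ q, y i (p q) with hΦ
  have key : (Matrix.of fun i j => c i * conj (c j) * inner ℂ (y j) (y i) ^ s) =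
      Φ * Φ.conjTranspose := by
    ext i j
    simp only [hΦ, Matrix.of_apply, Matrix.mul_apply, PiLp.inner_apply, RCLike.inner_apply,
      Matrix.conjTranspose_apply, Fintype.sum_pow, Finset.mul_sum]
    refine Finset.sum_congr rfl fun p _ => ?_
    simp only [Finset.prod_mul_distrib, star_mul', star_prod, RCLike.star_def]
    ring
  have hli : LinearIndependent ℂ Φ.row := by
    rw [Fintype.linearIndependent_iff]
    intro a ha
    have hz : (fun i => a i * c i) = 0 := by
      refine Matrix.eq_zero_of_forall_pow_sum_mul_pow_eq_zero hl fun e => ?_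
      -- The multi-index with `e` entries `l` and the rest `k` picks out `(y i l)^e`, as `y i k =
      -- 1`.
      have h := congrFun ha fun q : Fin s => if (q : ℕ) < e then l else k
      simp only [Finset.sum_apply, Pi.smul_apply, Matrix.row_apply, hΦ, Matrix.of_apply,
        smul_eq_mul, Pi.zero_apply] at h
      rw [← h]
      refine Finset.sum_congr rfl fun i _ => ?_
      rw [mul_assoc]
      congr 2
      simp only [apply_ite (fun q => y i q), hk, Finset.prod_ite, Finset.prod_const, one_pow,
        mul_one]
      congr 1
      have he : (e : ℕ) ≤ s := Nat.lt_succ_iff.1 e.2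
      rw [Fin.card_filter_val_lt, min_eq_right he]
    intro i
    simpa [hc i] using congrFun hz i
  rw [key, Matrix.rank_self_mul_conjTranspose, hli.rank_matrix, Fintype.card_fin]

theorem succ_le_choose_of_inner_pow_eq {ι κ : Type*} [Fintype ι] [Fintype κ] {r s : ℕ}
    (x : Fin (s + 1) → EuclideanSpace ℂ ι) (y : Fin (s + 1) → EuclideanSpace ℂ κ)
    (c : Fin (s + 1) → ℂ) (hc : ∀ i, c i ≠ 0) (k l : κ) (hk : ∀ i, y i k = 1)
    (hl : Function.Injective fun i => y i l)
    (h : ∀ i j, inner ℂ (x j) (x i) ^ r = c i * conj (c j) * inner ℂ (y j) (y i) ^ s) :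
    s + 1 ≤ (Fintype.card ι + r - 1).choose r := by
  rw [← rank_of_mul_inner_pow y c hc k l hk hl]
  simp only [← h]
  exact rank_of_inner_pow_le x r

end GramMatrix

/-! ### Identity theorem and polarization -/

theorem eqOn_ball_of_eq_ofReal {f : ℂ → ℂ} {R : ℝ} (hR : 0 < R)
    (hf : DifferentiableOn ℂ f (ball 0 R)) (h : ∀ x : ℝ, |x| < R → f x = 0) {z : ℂ}
    (hz : z ∈ ball (0 : ℂ) R) : f z = 0 := by
  refine (hf.analyticOnNhd isOpen_ball).eqOn_zero_of_preconnected_of_frequently_eq_zero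
    (convex_ball _ _).isPreconnected (mem_ball_self hR) ?_ hz
  have h1 : Tendsto (fun x : ℝ => (x : ℂ)) (𝓝[≠] 0) (𝓝[≠] 0) := by
    refine tendsto_nhdsWithin_iff.2 ⟨?_, ?_⟩
    · exact (Complex.continuous_ofReal.tendsto' 0 0 (by simp)).mono_left nhdsWithin_le_nhds
    · filter_upwards [self_mem_nhdsWithin] with x hx
      simpa using hx
  refine h1.frequently (Eventually.frequently ?_)
  filter_upwards [mem_nhdsWithin_of_mem_nhds (ball_mem_nhds (0 : ℝ) hR)] with x hx
  exact h x (by simpa using hx)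

/-- A function holomorphic in each of two variables that vanishes on `{(z, z̄)}` vanishes. -/
theorem eq_zero_of_eq_zero_on_conj_diagonal {G : ℂ → ℂ → ℂ} {R : ℝ} (hR : 0 < R)
    (hG : DifferentiableOn ℂ (fun p : ℂ × ℂ => G p.1 p.2) (ball 0 R ×ˢ ball 0 R))
    (h : ∀ z ∈ ball (0 : ℂ) R, G z (conj z) = 0) {z w : ℂ} (hz : z ∈ ball (0 : ℂ) (R / 2))
    (hw : w ∈ ball (0 : ℂ) (R / 2)) : G z w = 0 := by
  have hR2 : 0 < R / 2 := by positivity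
  have hmem : ∀ x y : ℂ, x ∈ ball (0 : ℂ) (R / 2) → y ∈ ball (0 : ℂ) (R / 2) →
      (x + Complex.I * y, x - Complex.I * y) ∈ ball (0 : ℂ) R ×ˢ ball (0 : ℂ) R := by
    intro x y hx hy
    simp only [mem_ball_zero_iff, Set.mem_prod] at *
    have hI : ‖Complex.I * y‖ = ‖y‖ := by simp
    constructor
    · linarith [norm_add_le x (Complex.I * y)]
    · linarith [norm_sub_le x (Complex.I * y)]
  -- In the coordinates `z = x + iy`, `w = x - iy`, the conjugate diagonal is the locus where `x`
  -- and `y` are real. The change of variables costs half the radius.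
  have hd : DifferentiableOn ℂ
      (fun p : ℂ × ℂ => G (p.1 + Complex.I * p.2) (p.1 - Complex.I * p.2))
      (ball 0 (R / 2) ×ˢ ball 0 (R / 2)) :=
    hG.comp (f := fun p : ℂ × ℂ => (p.1 + Complex.I * p.2, p.1 - Complex.I * p.2))
      (by fun_prop) fun p hp => hmem _ _ hp.1 hp.2
  -- The variables are freed one at a time: first `x` with `y` still real, then `y`.
  have hreal : ∀ y : ℝ, |y| < R / 2 → ∀ x ∈ ball (0 : ℂ) (R / 2),
      G (x + Complex.I * y) (x - Complex.I * y) = 0 := by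
    intro y hy x hx
    have hy' : (y : ℂ) ∈ ball (0 : ℂ) (R / 2) := by simpa using hy
    refine eqOn_ball_of_eq_ofReal
      (f := fun x : ℂ => G (x + Complex.I * y) (x - Complex.I * y)) hR2 ?_ ?_ hx
    · exact hd.comp (f := fun x : ℂ => (x, (y : ℂ))) (by fun_prop) fun x hx => ⟨hx, hy'⟩
    · intro x hx
      have := h _ (hmem x y (by simpa using hx) hy').1
      simpa [sub_eq_add_neg] using this
  have hall : ∀ x ∈ ball (0 : ℂ) (R / 2), ∀ y ∈ ball (0 : ℂ) (R / 2),
      G (x + Complex.I * y) (x - Complex.I * y) = 0 := by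
    intro x hx y hy
    refine eqOn_ball_of_eq_ofReal
      (f := fun y : ℂ => G (x + Complex.I * y) (x - Complex.I * y)) hR2 ?_ ?_ hy
    · exact hd.comp (f := fun y : ℂ => (x, y)) (by fun_prop) fun y hy => ⟨hx, hy⟩
    · exact fun y hy => hreal y hy x hx
  have hx : (z + w) / 2 ∈ ball (0 : ℂ) (R / 2) := by
    simp only [mem_ball_zero_iff, norm_div, Complex.norm_ofNat] at *
    linarith [norm_add_le z w]
  have hy : (z - w) / (2 * Complex.I) ∈ ball (0 : ℂ) (R / 2) := by
    simp only [mem_ball_zero_iff, norm_div, norm_mul, Complex.norm_I, Complex.norm_ofNat] at *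
    linarith [norm_sub_le z w]
  have := hall _ hx _ hy
  have e1 : (z + w) / 2 + Complex.I * ((z - w) / (2 * Complex.I)) = z := by
    field_simp; ring
  have e2 : (z + w) / 2 - Complex.I * ((z - w) / (2 * Complex.I)) = w := by
    field_simp; ring
  rwa [e1, e2] at this

theorem differentiableOn_conj_conj {f : ℂ → ℂ} {R : ℝ} (hf : DifferentiableOn ℂ f (ball 0 R)) :
    DifferentiableOn ℂ (fun w => conj (f (conj w))) (ball 0 R) := by
  intro w hw
  have hw' : conj w ∈ ball (0 : ℂ) R := by simpa using hw
  have := (hf.differentiableAt (isOpen_ball.mem_nhds hw')).conj_conj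
  simp only [Complex.conj_conj] at this
  exact this.differentiableWithinAt

/-- Polarization. -/
theorem inner_pow_eq_of_norm_pow_eq {ι κ : Type*} [Fintype ι] [Fintype κ]
    {V : ℂ → EuclideanSpace ℂ ι} {W : ℂ → EuclideanSpace ℂ κ} {h : ℂ → ℂ} {R : ℝ} (hR : 0 < R)
    {r s : ℕ}
    (hV : DifferentiableOn ℂ V (ball 0 R)) (hW : DifferentiableOn ℂ W (ball 0 R))
    (hh : DifferentiableOn ℂ h (ball 0 R))
    (heq : ∀ z ∈ ball (0 : ℂ) R, inner ℂ (V z) (V z) ^ r =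
      h z * conj (h z) * inner ℂ (W z) (W z) ^ s)
    {z w : ℂ} (hz : z ∈ ball (0 : ℂ) (R / 2)) (hw : w ∈ ball (0 : ℂ) (R / 2)) :
    inner ℂ (V w) (V z) ^ r = h z * conj (h w) * inner ℂ (W w) (W z) ^ s := by
  have hfst : Set.MapsTo (Prod.fst : ℂ × ℂ → ℂ) (ball 0 R ×ˢ ball 0 R) (ball 0 R) := fun _ h => h.1
  have hsnd : Set.MapsTo (Prod.snd : ℂ × ℂ → ℂ) (ball 0 R ×ˢ ball 0 R) (ball 0 R) := fun _ h => h.2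
  have prodDiff : ∀ f : ℂ → ℂ, DifferentiableOn ℂ f (ball 0 R) →
      DifferentiableOn ℂ (fun p : ℂ × ℂ => f p.1 * conj (f (conj p.2)))
        (ball 0 R ×ˢ ball 0 R) := fun f hf =>
    (hf.comp differentiableOn_fst hfst).mul
      ((differentiableOn_conj_conj hf).comp differentiableOn_snd hsnd)
  -- Conjugating the second variable makes the sesquiholomorphic kernel holomorphic in both.
  have hG : DifferentiableOn ℂ (fun p : ℂ × ℂ =>
      (∑ k, V p.1 k * conj (V (conj p.2) k)) ^ r -
        h p.1 * conj (h (conj p.2)) * (∑ k, W p.1 k * conj (W (conj p.2) k)) ^ s)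
      (ball 0 R ×ˢ ball 0 R) := by
    refine ((DifferentiableOn.fun_sum fun k _ => ?_).pow r).sub
      ((prodDiff h hh).mul ((DifferentiableOn.fun_sum fun k _ => ?_).pow s))
    · exact prodDiff (fun z => V z k) ((differentiableOn_euclidean.1 hV) k)
    · exact prodDiff (fun z => W z k) ((differentiableOn_euclidean.1 hW) k)
  have := eq_zero_of_eq_zero_on_conj_diagonal (G := fun z w =>
      (∑ k, V z k * conj (V (conj w) k)) ^ r -
        h z * conj (h (conj w)) * (∑ k, W z k * conj (W (conj w) k)) ^ s) hR hG
    (fun z hz => by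
      have := heq z hz
      simp only [PiLp.inner_apply, RCLike.inner_apply] at this
      simp [this]) hz (w := conj w) (by simpa using hw)
  simp only [Complex.conj_conj] at this
  simpa only [PiLp.inner_apply, RCLike.inner_apply] using sub_eq_zero.1 this

/-! ### The Fubini–Study form along holomorphic curves -/

section Curves

variable {E F : Type*} [NormedAddCommGroup E] [InnerProductSpace ℂ E]
  [NormedAddCommGroup F] [InnerProductSpace ℂ F]

/-- The Fubini–Study form `∂∂̄ log ‖v‖²` at `v` in the direction `v'`. -/
noncomputable def fsForm (v v' : E) : ℂ :=
  (inner ℂ v v * inner ℂ v' v' - inner ℂ v' v * inner ℂ v v') / inner ℂ v v ^ 2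

/-- The numerator of `fsForm` is the Gram determinant of `v, v'`: a multiple of `v` added to `v'`
does not change it, and the factor `|c|⁴` cancels. Hence the form along a curve does not depend on
the lift. -/
theorem fsForm_smul {c : ℂ} (hc : c ≠ 0) (c' : ℂ) {v : E} (hv : v ≠ 0) (v' : E) :
    fsForm (c • v) (c' • v + c • v') = fsForm v v' := by
  have hv0 : inner ℂ v v ≠ 0 := inner_self_ne_zero.2 hv
  have hcc : conj c ≠ 0 := by simpa using hc
  simp only [fsForm, inner_add_left, inner_add_right, inner_smul_left, inner_smul_right]
  field_simp
  ring

theorem HasDerivAt.hasDerivAt_line {f : ℂ → E} {f' : E} {t : ℂ} (hf : HasDerivAt f f' t) (ζ : ℂ) :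
    HasDerivAt (fun x : ℝ => f (t + x • ζ)) (ζ • f') 0 := by
  have h1 : HasDerivAt (fun x : ℝ => t + x • ζ) ζ 0 := by
    simpa using ((hasDerivAt_id (0 : ℝ)).smul_const ζ).const_add t
  have h2 : HasFDerivAt f (ContinuousLinearMap.toSpanSingleton ℂ f') (t + (0 : ℝ) • ζ) := by
    simpa using hf.hasFDerivAt
  simpa [Function.comp_def] using (h2.restrictScalars ℝ).comp_hasDerivAt (0 : ℝ) h1

theorem hasDerivAt_log_add_re_inner_self {γ : ℝ → E} {γ' : E} {x : ℝ} (hγ : HasDerivAt γ γ' x)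
    (c : ℝ) (h0 : c + (inner ℂ (γ x) (γ x)).re ≠ 0) :
    HasDerivAt (fun y => Real.log (c + (inner ℂ (γ y) (γ y)).re))
      (2 * (inner ℂ (γ x) γ').re / (c + (inner ℂ (γ x) (γ x)).re)) x := by
  have h1 := Complex.reCLM.hasFDerivAt.comp_hasDerivAt x (hγ.inner ℂ hγ)
  have h2 := (h1.const_add c).log h0
  have h3 : Complex.reCLM (inner ℂ (γ x) γ' + inner ℂ γ' (γ x)) = 2 * (inner ℂ (γ x) γ').re := by
    have h4 : (inner ℂ γ' (γ x)).re = (inner ℂ (γ x) γ').re := inner_re_symm (𝕜 := ℂ) _ _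
    rw [Complex.reCLM_apply, Complex.add_re, h4]
    ring
  rw [h3] at h2
  exact h2

theorem differentiableAt_log_re_inner_self {V : ℂ → E} {t : ℂ} (hV : DifferentiableAt ℂ V t)
    (h0 : V t ≠ 0) :
    DifferentiableAt ℝ (fun z => Real.log (inner ℂ (V z) (V z)).re) t := by
  have h1 : DifferentiableAt ℝ V t := hV.restrictScalars ℝ
  refine DifferentiableAt.log (Complex.reCLM.differentiableAt.comp t (h1.inner ℂ h1)) ?_
  exact (re_inner_self_pos (𝕜 := ℂ).2 h0).ne'

theorem fderiv_log_re_inner_self {V : ℂ → E} {V' : E} {t : ℂ} (hV : HasDerivAt V V' t)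
    (h0 : V t ≠ 0) (ζ : ℂ) :
    fderiv ℝ (fun z => Real.log (inner ℂ (V z) (V z)).re) t ζ =
      2 * (ζ * (inner ℂ (V t) V' / inner ℂ (V t) (V t))).re := by
  rw [← (differentiableAt_log_re_inner_self hV.differentiableAt h0).lineDeriv_eq_fderiv]
  have hpos : 0 < (inner ℂ (V t) (V t)).re := re_inner_self_pos (𝕜 := ℂ).2 h0
  have := hasDerivAt_log_add_re_inner_self (hV.hasDerivAt_line ζ) 0 (by simpa using hpos.ne')
  simp only [zero_add, zero_smul, add_zero] at this
  rw [lineDeriv, this.deriv, inner_smul_right, ← mul_div_assoc]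
  have hr : inner ℂ (V t) (V t) = (((inner ℂ (V t) (V t)).re : ℝ) : ℂ) := 
    (inner_self_ofReal_re (𝕜 := ℂ) (V t)).symm
  rw [hr, Complex.div_ofReal_re, Complex.ofReal_re, mul_div_assoc]

theorem differentiableAt_inner_div_inner {V U : ℂ → E} {t : ℂ} (hV : DifferentiableAt ℂ V t)
    (hU : DifferentiableAt ℂ U t) (h0 : V t ≠ 0) :
    DifferentiableAt ℝ (fun z => inner ℂ (V z) (U z) / inner ℂ (V z) (V z)) t := by
  have h1 : DifferentiableAt ℝ V t := hV.restrictScalars ℝ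
  have h2 : DifferentiableAt ℝ U t := hU.restrictScalars ℝ
  simp only [div_eq_mul_inv]
  exact (h1.inner ℂ h2).fun_mul ((h1.inner ℂ h1).fun_inv (inner_self_ne_zero.2 h0))

/-- The antilinear part of the derivative of `∂ log ‖V‖²` is the Fubini–Study form. -/
theorem fderiv_inner_div_inner {V U : ℂ → E} {U' : E} {t : ℂ} (hV : HasDerivAt V (U t) t)
    (hU : HasDerivAt U U' t) (h0 : V t ≠ 0) (ζ : ℂ) :
    fderiv ℝ (fun z => inner ℂ (V z) (U z) / inner ℂ (V z) (V z)) t ζ =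
      ζ * (inner ℂ (V t) U' / inner ℂ (V t) (V t) -
        inner ℂ (V t) (U t) ^ 2 / inner ℂ (V t) (V t) ^ 2) + conj ζ * fsForm (V t) (U t) := by
  rw [← (differentiableAt_inner_div_inner hV.differentiableAt hU.differentiableAt
    h0).lineDeriv_eq_fderiv]
  have h0' : inner ℂ (V t) (V t) ≠ 0 := inner_self_ne_zero.2 h0
  have hV' := hV.hasDerivAt_line ζ
  have hU' := hU.hasDerivAt_line ζ
  have := (hV'.inner ℂ hU').fun_div (hV'.inner ℂ hV') (by simpa using h0)
  simp only [zero_smul, add_zero] at this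
  rw [lineDeriv, this.deriv]
  simp only [fsForm, inner_smul_left, inner_smul_right]
  field_simp
  ring

variable [CompleteSpace E] [CompleteSpace F]

/-- Put `H = r ∂ log ‖V‖² - s ∂ log ‖W‖²`. Its antilinear derivative is the difference of the two
forms, so `H` is holomorphic and has a primitive `P` on the ball. Then `r log ‖V‖² - s log ‖W‖² - 2
Re P` has zero derivative, hence is constant, and exponentiating gives the claim. -/
theorem exists_norm_pow_eq_of_fsForm_eq {V : ℂ → E} {W : ℂ → F} {R : ℝ} {r s : ℕ}
    (hV : DifferentiableOn ℂ V (ball 0 R)) (hW : DifferentiableOn ℂ W (ball 0 R))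
    (hV0 : ∀ t ∈ ball (0 : ℂ) R, V t ≠ 0) (hW0 : ∀ t ∈ ball (0 : ℂ) R, W t ≠ 0)
    (hVW : ∀ t ∈ ball (0 : ℂ) R,
      (r : ℂ) * fsForm (V t) (deriv V t) = s * fsForm (W t) (deriv W t)) :
    ∃ h : ℂ → ℂ, DifferentiableOn ℂ h (ball 0 R) ∧ (∀ t, h t ≠ 0) ∧
      ∀ t ∈ ball (0 : ℂ) R, inner ℂ (V t) (V t) ^ r =
        h t * conj (h t) * inner ℂ (W t) (W t) ^ s := by
  have dV : ∀ t ∈ ball (0 : ℂ) R, HasDerivAt V (deriv V t) t := fun t ht =>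
    (hV.differentiableAt (isOpen_ball.mem_nhds ht)).hasDerivAt
  have dW : ∀ t ∈ ball (0 : ℂ) R, HasDerivAt W (deriv W t) t := fun t ht =>
    (hW.differentiableAt (isOpen_ball.mem_nhds ht)).hasDerivAt
  have ddV : ∀ t ∈ ball (0 : ℂ) R, HasDerivAt (deriv V) (deriv (deriv V) t) t := fun t ht =>
    ((hV.deriv isOpen_ball).differentiableAt (isOpen_ball.mem_nhds ht)).hasDerivAt
  have ddW : ∀ t ∈ ball (0 : ℂ) R, HasDerivAt (deriv W) (deriv (deriv W) t) t := fun t ht =>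
    ((hW.deriv isOpen_ball).differentiableAt (isOpen_ball.mem_nhds ht)).hasDerivAt
  set H : ℂ → ℂ := fun t => r * (inner ℂ (V t) (deriv V t) / inner ℂ (V t) (V t)) -
    s * (inner ℂ (W t) (deriv W t) / inner ℂ (W t) (W t)) with hH
  have dH : DifferentiableOn ℂ H (ball 0 R) := by
    intro t ht
    refine DifferentiableAt.differentiableWithinAt ?_
    have e1 := (differentiableAt_inner_div_inner (dV t ht).differentiableAt
      (ddV t ht).differentiableAt (hV0 t ht)).const_mul (r : ℂ)
    have e2 := (differentiableAt_inner_div_inner (dW t ht).differentiableAt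
      (ddW t ht).differentiableAt (hW0 t ht)).const_mul (s : ℂ)
    refine differentiableAt_complex_iff_differentiableAt_real.2 ⟨e1.sub e2, ?_⟩
    have e3 : ∀ ζ, fderiv ℝ H t ζ = _ := fun ζ => by
      rw [hH, fderiv_fun_sub e1 e2, sub_apply,
        fderiv_const_mul (differentiableAt_inner_div_inner (dV t ht).differentiableAt
          (ddV t ht).differentiableAt (hV0 t ht)),
        fderiv_const_mul (differentiableAt_inner_div_inner (dW t ht).differentiableAt
          (ddW t ht).differentiableAt (hW0 t ht)),
        smul_apply, smul_apply,
        fderiv_inner_div_inner (dV t ht) (ddV t ht) (hV0 t ht),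
        fderiv_inner_div_inner (dW t ht) (ddW t ht) (hW0 t ht)]
    rw [e3, e3]
    simp only [smul_eq_mul, Complex.conj_I, map_one]
    -- For a derivative `ζ ↦ ζ A + conj ζ B`, the Cauchy–Riemann defect is `-2i B`.
    linear_combination (-2 * Complex.I) * hVW t ht
  obtain ⟨P, hP⟩ := dH.isExactOn_ball
  set k : ℂ → ℝ := fun t => r * Real.log (inner ℂ (V t) (V t)).re -
    s * Real.log (inner ℂ (W t) (W t)).re - 2 * (P t).re with hk
  have dk : ∀ t ∈ ball (0 : ℂ) R, HasFDerivAt k (0 : ℂ →L[ℝ] ℝ) t := by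
    intro t ht
    have e1 := (differentiableAt_log_re_inner_self (dV t ht).differentiableAt
      (hV0 t ht)).hasFDerivAt.const_mul (r : ℝ)
    have e2 := (differentiableAt_log_re_inner_self (dW t ht).differentiableAt
      (hW0 t ht)).hasFDerivAt.const_mul (s : ℝ)
    have e3 := (Complex.reCLM.hasFDerivAt.comp t
      ((hP t ht).hasFDerivAt.restrictScalars ℝ)).const_mul (2 : ℝ)
    refine ((e1.sub e2).sub e3).congr_fderiv (ContinuousLinearMap.ext fun ζ => ?_)
    simp only [sub_apply, smul_apply,
      fderiv_log_re_inner_self (dV t ht) (hV0 t ht), fderiv_log_re_inner_self (dW t ht) (hW0 t ht)]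
    have : ζ * H t = (r : ℝ) * (ζ * (inner ℂ (V t) (deriv V t) / inner ℂ (V t) (V t))) -
        (s : ℝ) * (ζ * (inner ℂ (W t) (deriv W t) / inner ℂ (W t) (W t))) := by
      simp only [hH, Complex.ofReal_natCast]; ring
    have hre := congrArg Complex.re this
    rw [Complex.sub_re, Complex.re_ofReal_mul, Complex.re_ofReal_mul] at hre
    simp only [zero_apply, ContinuousLinearMap.comp_apply,
      ContinuousLinearMap.coe_restrictScalars', ContinuousLinearMap.toSpanSingleton_apply,
      smul_eq_mul, Complex.reCLM_apply, hre]
    ring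
  have hconst : ∀ t ∈ ball (0 : ℂ) R, k t = k 0 := by
    intro t ht
    have h0 : (0 : ℂ) ∈ ball (0 : ℂ) R := mem_ball_self (pos_of_mem_ball ht)
    exact (convex_ball (0 : ℂ) R).is_const_of_fderivWithin_eq_zero (𝕜 := ℝ)
      (fun x hx => (dk x hx).differentiableAt.differentiableWithinAt)
      (fun x hx => (dk x hx).hasFDerivWithinAt.fderivWithin
        (isOpen_ball.uniqueDiffWithinAt hx)) ht h0
  -- The constant is halved because `h * conj h` doubles the real part of the exponent.
  refine ⟨fun t => Complex.exp (P t + (k 0 / 2 : ℝ)), ?_, fun t => Complex.exp_ne_zero _, ?_⟩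
  · exact fun t ht => (((hP t ht).differentiableAt.add_const _).cexp).differentiableWithinAt
  · intro t ht
    have hVp : 0 < (inner ℂ (V t) (V t)).re := re_inner_self_pos (𝕜 := ℂ).2 (hV0 t ht)
    have hWp : 0 < (inner ℂ (W t) (W t)).re := re_inner_self_pos (𝕜 := ℂ).2 (hW0 t ht)
    have hVr : inner ℂ (V t) (V t) = (((inner ℂ (V t) (V t)).re : ℝ) : ℂ) :=
      (inner_self_ofReal_re (𝕜 := ℂ) (V t)).symm
    have hWr : inner ℂ (W t) (W t) = (((inner ℂ (W t) (W t)).re : ℝ) : ℂ) :=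
      (inner_self_ofReal_re (𝕜 := ℂ) (W t)).symm
    have hkt := hconst t ht
    have hkt' : k t = r * Real.log (inner ℂ (V t) (V t)).re -
      s * Real.log (inner ℂ (W t) (W t)).re - 2 * (P t).re := rfl
    have hreal : (inner ℂ (V t) (V t)).re ^ r =
        Real.exp (2 * (P t).re + k 0) * (inner ℂ (W t) (W t)).re ^ s := by
      rw [← Real.exp_log (pow_pos hVp r), ← Real.exp_log (pow_pos hWp s), ← Real.exp_add,
        Real.log_pow, Real.log_pow]
      congr 1
      linarith
    have hexp : P t + (k 0 / 2 : ℝ) + conj (P t + (k 0 / 2 : ℝ)) =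
        ((2 * (P t).re + k 0 : ℝ) : ℂ) := by
      rw [Complex.add_conj]
      simp
      ring
    rw [hVr, hWr, ← Complex.exp_conj, ← Complex.exp_add, ← Complex.ofReal_pow, hreal, hexp]
    push_cast
    rfl

end Curves

/-! ### The complex Hessian of the Fubini–Study potential -/

section Hessian

variable {E : Type*} [NormedAddCommGroup E] [InnerProductSpace ℂ E]

theorem one_add_inner_self (w : E) : 1 + inner ℂ w w = ((1 + ‖w‖ ^ 2 : ℝ) : ℂ) := by
  rw [inner_self_eq_norm_sq_to_K]
  push_cast
  rfl

theorem one_add_inner_self_ne_zero (w : E) : 1 + inner ℂ w w ≠ 0 := by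
  rw [one_add_inner_self]
  exact_mod_cast (by positivity : (1 + ‖w‖ ^ 2 : ℝ) ≠ 0)

theorem hasDerivAt_add_smul_zero (w u : E) :
    HasDerivAt (fun x : ℝ => w + x • u) u 0 := by
  simpa using ((hasDerivAt_id (0 : ℝ)).smul_const u).const_add w

theorem fderiv_log_one_add_norm_sq (c : ℝ) (w u : E) :
    fderiv ℝ (fun w : E => ((c * Real.log (1 + ‖w‖ ^ 2) : ℝ) : ℂ)) w u =
      ((c * (2 * (inner ℂ w u).re / (1 + ‖w‖ ^ 2)) : ℝ) : ℂ) := by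
  have hn : ∀ w : E, ‖w‖ ^ 2 = (inner ℂ w w).re := fun w =>
    (inner_self_eq_norm_sq (𝕜 := ℂ) w).symm
  have hpos : ∀ w : E, 1 + (inner ℂ w w).re ≠ 0 := fun w => by rw [← hn]; positivity
  simp only [hn]
  have hid : DifferentiableAt ℝ (fun w : E => w) w := differentiableAt_id
  have hd : DifferentiableAt ℝ
      (fun w : E => ((c * Real.log (1 + (inner ℂ w w).re) : ℝ) : ℂ)) w :=
    Complex.ofRealCLM.differentiableAt.comp w <| DifferentiableAt.const_mul
      (((Complex.reCLM.differentiableAt.comp w (hid.inner ℂ hid)).const_add 1).log (hpos w)) c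
  rw [← hd.lineDeriv_eq_fderiv, lineDeriv]
  have h := ((hasDerivAt_log_add_re_inner_self (hasDerivAt_add_smul_zero w u) 1
    (hpos _)).const_mul c).ofReal_comp
  simp only [zero_smul, add_zero] at h
  exact h.deriv

theorem dBar_log_one_add_norm_sq (c : ℝ) (w v : E) :
    dBar (fun w : E => ((c * Real.log (1 + ‖w‖ ^ 2) : ℝ) : ℂ)) w v =
      c * (inner ℂ v w / (1 + inner ℂ w w)) := by
  rw [dBar, fderiv_log_one_add_norm_sq, fderiv_log_one_add_norm_sq, one_add_inner_self,
    inner_smul_right, ← inner_conj_symm v w]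
  have h : ((1 + ‖w‖ ^ 2 : ℝ) : ℂ) ≠ 0 := by exact_mod_cast (by positivity : (1 + ‖w‖ ^ 2 : ℝ) ≠ 0)
  have hconj : ∀ x : ℂ, conj x = x.re - x.im * Complex.I := fun x => by
    apply Complex.ext <;> simp
  rw [hconj, Complex.I_mul_re]
  simp only [Complex.ofReal_mul, Complex.ofReal_div]
  field_simp
  push_cast
  ring

theorem complexHessian_log_one_add_norm_sq (c : ℝ) (w u v : E) :
    complexHessian (fun w : E => ((c * Real.log (1 + ‖w‖ ^ 2) : ℝ) : ℂ)) w u v =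
      c * (inner ℂ v u / (1 + inner ℂ w w) -
        inner ℂ v w * inner ℂ w u / (1 + inner ℂ w w) ^ 2) := by
  have h0 := one_add_inner_self_ne_zero w
  simp only [complexHessian, dBar_log_one_add_norm_sq]
  have hd : DifferentiableAt ℝ
      (fun z : E => (c : ℂ) * (inner ℂ v z / (1 + inner ℂ z z))) w := by
    have hid : DifferentiableAt ℝ (fun w : E => w) w := differentiableAt_id
    simp only [div_eq_mul_inv]
    exact DifferentiableAt.const_mul (((differentiableAt_const v).inner ℂ hid).fun_mul
      (((hid.inner ℂ hid).const_add 1).fun_inv h0)) _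
  have key : ∀ u, fderiv ℝ (fun z : E => (c : ℂ) * (inner ℂ v z / (1 + inner ℂ z z))) w u =
      c * ((inner ℂ v u * (1 + inner ℂ w w) - inner ℂ v w * (inner ℂ w u + inner ℂ u w)) /
        (1 + inner ℂ w w) ^ 2) := by
    intro u
    rw [← hd.lineDeriv_eq_fderiv, lineDeriv]
    have hl := hasDerivAt_add_smul_zero w u
    have h := (((hasDerivAt_const (0 : ℝ) v).inner ℂ hl).fun_div
      ((hl.inner ℂ hl).const_add 1) (by simpa using h0)).const_mul (c : ℂ)
    simp only [zero_smul, add_zero, inner_zero_left] at h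
    exact h.deriv
  rw [dHol, key, key]
  simp only [inner_smul_left, inner_smul_right, Complex.conj_I]
  field_simp
  ring_nf
  simp only [Complex.I_sq]
  ring

end Hessian

/-! ### Affine lifts of curves in projective space -/

theorem hasDerivAt_euclidean {ι : Type*} [Fintype ι] {f : ℂ → EuclideanSpace ℂ ι}
    {f' : EuclideanSpace ℂ ι} {t : ℂ} :
    HasDerivAt f f' t ↔ ∀ l, HasDerivAt (fun τ => f τ l) (f' l) t := by
  rw [← hasDerivAt_pi (φ := fun τ l => f τ l) (φ' := fun l => f' l)]
  exact ⟨fun h => (EuclideanSpace.equiv ι ℂ).hasFDerivAt.comp_hasDerivAt t h,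
    fun h => (EuclideanSpace.equiv ι ℂ).symm.hasFDerivAt.comp_hasDerivAt t h⟩

namespace FubiniStudy

variable {n : ℕ} {b : ℝ}

/-- The homogeneous coordinates with `ξᵢ = 1` as a vector of the Euclidean space. -/
noncomputable def lift (i : Fin (n + 1)) (w : EuclideanSpace ℂ (Fin n)) :
    EuclideanSpace ℂ (Fin (n + 1)) :=
  WithLp.toLp 2 (homog i w).1

/-- The derivative of `lift i`. -/
noncomputable def tangentLift (i : Fin (n + 1)) (u : EuclideanSpace ℂ (Fin n)) :
    EuclideanSpace ℂ (Fin (n + 1)) :=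
  WithLp.toLp 2 (i.insertNth (0 : ℂ) (fun j => u j))

@[simp]
theorem lift_self (i : Fin (n + 1)) (w : EuclideanSpace ℂ (Fin n)) : lift i w i = 1 := by
  simp [lift, homog]

@[simp]
theorem lift_succAbove (i : Fin (n + 1)) (w : EuclideanSpace ℂ (Fin n)) (j : Fin n) :
    lift i w (i.succAbove j) = w j := by
  simp [lift, homog]

@[simp]
theorem tangentLift_self (i : Fin (n + 1)) (u : EuclideanSpace ℂ (Fin n)) :
    tangentLift i u i = 0 := by
  simp [tangentLift]

@[simp]
theorem tangentLift_succAbove (i : Fin (n + 1)) (u : EuclideanSpace ℂ (Fin n)) (j : Fin n) :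
    tangentLift i u (i.succAbove j) = u j := by
  simp [tangentLift]

theorem lift_ne_zero (i : Fin (n + 1)) (w : EuclideanSpace ℂ (Fin n)) : lift i w ≠ 0 := by
  intro h
  simpa [h] using lift_self i w

theorem fsForm_lift_tangentLift (i : Fin (n + 1)) (w u : EuclideanSpace ℂ (Fin n)) :
    fsForm (lift i w) (tangentLift i u) = inner ℂ u u / (1 + inner ℂ w w) -
      inner ℂ u w * inner ℂ w u / (1 + inner ℂ w w) ^ 2 := by
  have h0 := one_add_inner_self_ne_zero w
  have h1 : inner ℂ (lift i w) (lift i w) = 1 + inner ℂ w w := by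
    simp [-inner_self_eq_norm_sq_to_K, PiLp.inner_apply, Fin.sum_univ_succAbove _ i]
  have h2 : inner ℂ (lift i w) (tangentLift i u) = inner ℂ w u := by
    simp [PiLp.inner_apply, Fin.sum_univ_succAbove _ i]
  have h3 : inner ℂ (tangentLift i u) (lift i w) = inner ℂ u w := by
    simp [PiLp.inner_apply, Fin.sum_univ_succAbove _ i]
  have h4 : inner ℂ (tangentLift i u) (tangentLift i u) = inner ℂ u u := by
    simp [-inner_self_eq_norm_sq_to_K, PiLp.inner_apply, Fin.sum_univ_succAbove _ i]
  rw [fsForm, h1, h2, h3, h4]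
  field_simp

theorem hasDerivAt_lift (i : Fin (n + 1)) {w : ℂ → EuclideanSpace ℂ (Fin n)}
    {w' : EuclideanSpace ℂ (Fin n)} {t : ℂ} (hw : HasDerivAt w w' t) :
    HasDerivAt (fun τ => lift i (w τ)) (tangentLift i w') t := by
  have hw' := hasDerivAt_euclidean.1 hw
  refine hasDerivAt_euclidean.2 fun l => ?_
  induction l using Fin.succAboveCases i with
  | x => simpa using hasDerivAt_const t (1 : ℂ)
  | p j => simpa using hw' j

/-- Both lifts represent the same point; the factor is `ξ_j / ξ_i`, which `fsForm_smul` later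
removes. -/
theorem lift_affineCoord_eq_smul (i j : Fin (n + 1)) (x : FubiniStudy n b) (hi : CoordNeZero i x)
    (hj : CoordNeZero j x) :
    lift i (affineCoord i x) j ≠ 0 ∧
      lift i (affineCoord i x) = lift i (affineCoord i x) j • lift j (affineCoord j x) := by
  obtain ⟨v, rfl⟩ := isQuotientMap_proj.surjective x
  replace hi : v.1 i ≠ 0 := hi
  replace hj : v.1 j ≠ 0 := hj
  have key : ∀ (k : Fin (n + 1)), v.1 k ≠ 0 → ∀ l,
      lift k (affineCoord k (proj n b v)) l = v.1 l / v.1 k := by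
    intro k hk l
    induction l using Fin.succAboveCases k with
    | x => simp [hk]
    | p l => rw [lift_succAbove]; rfl
  refine ⟨by rw [key i hi]; exact div_ne_zero hj hi, ?_⟩
  ext l
  rw [PiLp.smul_apply, key i hi, key i hi, key j hj, smul_eq_mul]
  field_simp

theorem differentiableAt_affineCoord {γ : ℂ → FubiniStudy n b} {t : ℂ}
    (hγ : MDifferentiableAt 𝓘(ℂ, ℂ) 𝓘(ℂ, EuclideanSpace ℂ (Fin n)) γ t) (i : Fin (n + 1))
    (hi : CoordNeZero i (γ t)) : DifferentiableAt ℂ (fun τ => affineCoord i (γ τ)) t := by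
  have h := mdifferentiableAt_atlas (I := 𝓘(ℂ, EuclideanSpace ℂ (Fin n)))
    (e := affineChart b i) (Set.mem_range_self i) (x := γ t) hi
  exact mdifferentiableAt_iff_differentiableAt.1 (h.comp t hγ)

/-- `mfderiv` is read in the preferred chart at `γ t`. That chart is affine, but its index depends
on a choice at each point, hence the existential. -/
theorem exists_mfderiv_eq_deriv_affineCoord {γ : ℂ → FubiniStudy n b} {t : ℂ}
    (hγ : MDifferentiableAt 𝓘(ℂ, ℂ) 𝓘(ℂ, EuclideanSpace ℂ (Fin n)) γ t) :
    ∃ i : Fin (n + 1), CoordNeZero i (γ t) ∧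
      chartAt (EuclideanSpace ℂ (Fin n)) (γ t) = affineChart b i ∧
      mfderiv 𝓘(ℂ, ℂ) 𝓘(ℂ, EuclideanSpace ℂ (Fin n)) γ t (1 : ℂ) =
        deriv (fun τ => affineCoord i (γ τ)) t := by
  refine ⟨(exists_coordNeZero (γ t)).choose, (exists_coordNeZero (γ t)).choose_spec, rfl, ?_⟩
  rw [hγ.mfderiv]
  simp only [mfld_simps, fderivWithin_univ]
  rfl

theorem fubiniStudyMetric_self (x : FubiniStudy n b) (j : Fin (n + 1))
    (hchart : chartAt (EuclideanSpace ℂ (Fin n)) x = affineChart b j)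
    (u : EuclideanSpace ℂ (Fin n)) :
    fubiniStudyMetric n b x u u =
      ((1 / b : ℝ) : ℂ) * fsForm (lift j (affineCoord j x)) (tangentLift j u) := by
  have hx : chartAt (EuclideanSpace ℂ (Fin n)) x x = affineCoord j x := by rw [hchart]; rfl
  refine (complexHessian_log_one_add_norm_sq (1 / b)
    (chartAt (EuclideanSpace ℂ (Fin n)) x x) u u).trans ?_
  rw [hx, fsForm_lift_tangentLift]

/-- The metric along a curve is the Fubini–Study form of any of its affine lifts. -/
theorem fubiniStudyMetric_mfderiv {γ : ℂ → FubiniStudy n b} {t : ℂ}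
    (hγ : MDifferentiableAt 𝓘(ℂ, ℂ) 𝓘(ℂ, EuclideanSpace ℂ (Fin n)) γ t) (i : Fin (n + 1))
    (hi : CoordNeZero i (γ t)) :
    fubiniStudyMetric n b (γ t)
      (mfderiv 𝓘(ℂ, ℂ) 𝓘(ℂ, EuclideanSpace ℂ (Fin n)) γ t (1 : ℂ))
      (mfderiv 𝓘(ℂ, ℂ) 𝓘(ℂ, EuclideanSpace ℂ (Fin n)) γ t (1 : ℂ)) =
    ((1 / b : ℝ) : ℂ) * fsForm (lift i (affineCoord i (γ t)))
      (deriv (fun τ => lift i (affineCoord i (γ τ))) t) := by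
  obtain ⟨j, hj, hchart, hder⟩ := exists_mfderiv_eq_deriv_affineCoord hγ
  refine (congrArg₂ (fubiniStudyMetric n b (γ t)) hder hder).trans
    ((fubiniStudyMetric_self (γ t) j hchart _).trans ?_)
  congr 1
  have dj := hasDerivAt_lift j (differentiableAt_affineCoord hγ j hj).hasDerivAt
  have di := hasDerivAt_lift i (differentiableAt_affineCoord hγ i hi).hasDerivAt
  have dc := hasDerivAt_euclidean.1 di j
  -- The metric is given in the preferred chart `j`, which may vary with `t`; the fixed lift `i` is
  -- compared with it near `t`.
  have hev : (fun τ => lift i (affineCoord i (γ τ))) =ᶠ[𝓝 t]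
      fun τ => lift i (affineCoord i (γ τ)) j • lift j (affineCoord j (γ τ)) := by
    have h1 := hγ.continuousAt.eventually ((isOpen_coordNeZero i).mem_nhds hi)
    have h2 := hγ.continuousAt.eventually ((isOpen_coordNeZero j).mem_nhds hj)
    filter_upwards [h1, h2] with τ h1 h2
    exact (lift_affineCoord_eq_smul i j (γ τ) h1 h2).2
  obtain ⟨hne, heq⟩ := lift_affineCoord_eq_smul i j (γ t) hi hj
  have hsmul := fsForm_smul hne (tangentLift i (deriv (fun τ => affineCoord i (γ τ)) t) j)
    (lift_ne_zero j (affineCoord j (γ t))) (tangentLift j (deriv (fun τ => affineCoord j (γ τ)) t))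
  rw [← heq] at hsmul
  rw [hev.deriv_eq, (dc.fun_smul dj).deriv, add_comm (_ • _), hsmul]

end FubiniStudy

/-! ### Reduction to curves and conclusion -/

/-- Through every point of a complex manifold of positive dimension there is an immersed disc. -/
theorem exists_holomorphic_curve {d : ℕ} (hd : 1 ≤ d) {Z : Type} [TopologicalSpace Z]
    [ChartedSpace (EuclideanSpace ℂ (Fin d)) Z]
    [IsManifold 𝓘(ℂ, EuclideanSpace ℂ (Fin d)) ω Z] (z : Z) :
    ∃ θ : ℂ → Z,
      (∀ᶠ t in 𝓝 0, MDifferentiableAt 𝓘(ℂ, ℂ) 𝓘(ℂ, EuclideanSpace ℂ (Fin d)) θ t) ∧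
      mfderiv 𝓘(ℂ, ℂ) 𝓘(ℂ, EuclideanSpace ℂ (Fin d)) θ 0 (1 : ℂ) ≠ 0 := by
  have : IsManifold 𝓘(ℂ, EuclideanSpace ℂ (Fin d)) 1 Z := .of_le (n := ω) le_top
  set φ := chartAt (EuclideanSpace ℂ (Fin d)) z
  set e : EuclideanSpace ℂ (Fin d) := EuclideanSpace.single ⟨0, hd⟩ 1 with he
  have he0 : e ≠ 0 := by simp [he]
  set L : ℂ → EuclideanSpace ℂ (Fin d) := fun t => φ z + t • e with hL
  have hL0 : L 0 = φ z := by simp [hL]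
  have hLc : Continuous L := by fun_prop
  have hLd : ∀ t, HasDerivAt L e t := fun t => by
    have h := ((hasDerivAt_id t).smul_const e).const_add (φ z)
    rwa [one_smul] at h
  have hO : ∀ᶠ t in 𝓝 (0 : ℂ), L t ∈ φ.target := by
    refine hLc.continuousAt.eventually (φ.open_target.mem_nhds ?_)
    rw [hL0]
    exact mem_chart_target _ z
  have hθ : ∀ t, L t ∈ φ.target →
      MDifferentiableAt 𝓘(ℂ, ℂ) 𝓘(ℂ, EuclideanSpace ℂ (Fin d)) (φ.symm ∘ L) t := fun t ht =>
    (mdifferentiableAt_atlas_symm (chart_mem_atlas _ z) ht).comp t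
      (mdifferentiableAt_iff_differentiableAt.2 (hLd t).differentiableAt)
  refine ⟨φ.symm ∘ L, hO.mono hθ, fun h0 => he0 ?_⟩
  have hz : (φ.symm ∘ L) 0 = z := by
    simp only [Function.comp_apply, hL0]
    exact φ.left_inv (mem_chart_source _ z)
  have hφ : MDifferentiableAt 𝓘(ℂ, EuclideanSpace ℂ (Fin d)) 𝓘(ℂ, EuclideanSpace ℂ (Fin d)) φ
      ((φ.symm ∘ L) 0) := by
    rw [hz]
    exact mdifferentiableAt_atlas (chart_mem_atlas _ z) (mem_chart_source _ z)
  -- By the chain rule for `φ ∘ θ = L`, a zero velocity of `θ` would force `L' = e` to vanish.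
  have hcomp := mfderiv_comp 0 hφ (hθ 0 hO.self_of_nhds)
  have hev : φ ∘ (φ.symm ∘ L) =ᶠ[𝓝 0] L := hO.mono fun t ht => φ.right_inv ht
  rw [hev.mfderiv_eq, mfderiv_eq_fderiv] at hcomp
  have h1 := DFunLike.congr_fun hcomp (1 : ℂ)
  have h2 : fderiv ℂ L 0 (1 : ℂ) = e := by
    rw [fderiv_apply_one_eq_deriv]; exact (hLd 0).deriv
  refine h2.symm.trans (h1.trans ?_)
  exact (congrArg (mfderiv 𝓘(ℂ, EuclideanSpace ℂ (Fin d)) 𝓘(ℂ, EuclideanSpace ℂ (Fin d)) φ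
    ((φ.symm ∘ L) 0)) h0).trans (map_zero _)

namespace FubiniStudy

theorem succ_le_choose_of_curves {n m : ℕ} {a b : ℝ} (ha : 0 < a) (hb : 0 < b) {s r : ℕ}
    (hab : (s : ℝ) * a = (r : ℝ) * b) {γ : ℂ → FubiniStudy n b} {δ : ℂ → FubiniStudy m a}
    (hγ : ∀ᶠ t in 𝓝 0, MDifferentiableAt 𝓘(ℂ, ℂ) 𝓘(ℂ, EuclideanSpace ℂ (Fin n)) γ t)
    (hδ : ∀ᶠ t in 𝓝 0, MDifferentiableAt 𝓘(ℂ, ℂ) 𝓘(ℂ, EuclideanSpace ℂ (Fin m)) δ t)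
    (h0 : mfderiv 𝓘(ℂ, ℂ) 𝓘(ℂ, EuclideanSpace ℂ (Fin m)) δ 0 (1 : ℂ) ≠ 0)
    (h : ∀ᶠ t in 𝓝 0, fubiniStudyMetric n b (γ t)
        (mfderiv 𝓘(ℂ, ℂ) 𝓘(ℂ, EuclideanSpace ℂ (Fin n)) γ t (1 : ℂ))
        (mfderiv 𝓘(ℂ, ℂ) 𝓘(ℂ, EuclideanSpace ℂ (Fin n)) γ t (1 : ℂ)) =
      fubiniStudyMetric m a (δ t)
        (mfderiv 𝓘(ℂ, ℂ) 𝓘(ℂ, EuclideanSpace ℂ (Fin m)) δ t (1 : ℂ))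
        (mfderiv 𝓘(ℂ, ℂ) 𝓘(ℂ, EuclideanSpace ℂ (Fin m)) δ t (1 : ℂ))) :
    s + 1 ≤ (r + n).choose r := by
  obtain ⟨i, hi⟩ := exists_coordNeZero (γ 0)
  obtain ⟨j, hj, -, hder⟩ := exists_mfderiv_eq_deriv_affineCoord hδ.self_of_nhds
  have hi' := hγ.self_of_nhds.continuousAt.eventually ((isOpen_coordNeZero i).mem_nhds hi)
  have hj' := hδ.self_of_nhds.continuousAt.eventually ((isOpen_coordNeZero j).mem_nhds hj)
  obtain ⟨R, hR, hball⟩ := Metric.eventually_nhds_iff_ball.1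
    (hγ.and (hδ.and (h.and (hi'.and hj'))))
  set V : ℂ → EuclideanSpace ℂ (Fin (n + 1)) := fun t => lift i (affineCoord i (γ t)) with hVdef
  set W : ℂ → EuclideanSpace ℂ (Fin (m + 1)) := fun t => lift j (affineCoord j (δ t)) with hWdef
  have hV : DifferentiableOn ℂ V (ball 0 R) := fun t ht => by
    obtain ⟨h1, -, -, h4, -⟩ := hball t ht
    exact (hasDerivAt_lift i (differentiableAt_affineCoord h1 i
      h4).hasDerivAt).differentiableAt.differentiableWithinAt
  have hW : DifferentiableOn ℂ W (ball 0 R) := fun t ht => by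
    obtain ⟨-, h2, -, -, h5⟩ := hball t ht
    exact (hasDerivAt_lift j (differentiableAt_affineCoord h2 j
      h5).hasDerivAt).differentiableAt.differentiableWithinAt
  have hform : ∀ t ∈ ball (0 : ℂ) R,
      (r : ℂ) * fsForm (V t) (deriv V t) = s * fsForm (W t) (deriv W t) := by
    intro t ht
    obtain ⟨h1, h2, h3, h4, h5⟩ := hball t ht
    rw [fubiniStudyMetric_mfderiv h1 i h4, fubiniStudyMetric_mfderiv h2 j h5] at h3
    have hab' : (s : ℂ) * a = r * b := by exact_mod_cast hab
    have ha' : (a : ℂ) ≠ 0 := by exact_mod_cast ha.ne'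
    have hb' : (b : ℂ) ≠ 0 := by exact_mod_cast hb.ne'
    push_cast at h3
    have h6 : (a : ℂ) * fsForm (V t) (deriv V t) = b * fsForm (W t) (deriv W t) := by
      field_simp at h3
      rw [mul_comm]
      exact h3
    refine mul_left_cancel₀ hb' ?_
    -- After multiplication by `b`: `r b = s a` turns the left side into `s` times `h6`.
    linear_combination (-fsForm (V t) (deriv V t)) * hab' + (s : ℂ) * h6
  obtain ⟨p, hp, hp0, heq⟩ := exists_norm_pow_eq_of_fsForm_eq hV hW
    (fun t _ => lift_ne_zero _ _) (fun t _ => lift_ne_zero _ _) hform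
  have hder0 : deriv (fun τ => affineCoord j (δ τ)) 0 ≠ 0 := fun h => h0 (hder.trans h)
  obtain ⟨l, hl⟩ : ∃ l, deriv (fun τ => affineCoord j (δ τ)) 0 l ≠ 0 := by
    by_contra! hl
    exact hder0 (by ext l; exact hl l)
  have hWl : DifferentiableOn ℂ (fun t => W t (j.succAbove l)) (ball 0 R) :=
    differentiableOn_euclidean.1 hW _
  have hderl : HasStrictDerivAt (fun t => W t (j.succAbove l))
      (deriv (fun τ => affineCoord j (δ τ)) 0 l) 0 := by
    have h1 := (hWl.analyticAt (ball_mem_nhds 0 hR)).hasStrictDerivAt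
    have h2 := hasDerivAt_euclidean.1 (hasDerivAt_lift j
      (differentiableAt_affineCoord hδ.self_of_nhds j hj).hasDerivAt) (j.succAbove l)
    rw [tangentLift_succAbove] at h2
    rwa [h2.deriv] at h1
  -- A coordinate with nonzero derivative is open at `0`, so it takes infinitely many values on the
  -- half ball where polarization holds.
  have hinf : ((fun t => W t (j.succAbove l)) '' ball 0 (R / 2)).Infinite := by
    have hn := image_mem_map (m := fun t => W t (j.succAbove l))
      (ball_mem_nhds (0 : ℂ) (half_pos hR))
    rw [hderl.map_nhds_eq hl] at hn
    exact infinite_of_mem_nhds _ hn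
  have hcard := hinf.exists_subset_card_eq (s + 1)
  obtain ⟨S, hS, hScard⟩ := hcard
  have hpt : ∀ q : Fin (s + 1), ∃ t ∈ ball (0 : ℂ) (R / 2),
      W t (j.succAbove l) = (S.equivFinOfCardEq hScard).symm q := fun q =>
    hS ((S.equivFinOfCardEq hScard).symm q).2
  choose t ht htS using hpt
  have hfin := succ_le_choose_of_inner_pow_eq (r := r) (fun q => V (t q)) (fun q => W (t q))
    (fun q => p (t q)) (fun q => hp0 _) j (j.succAbove l) (fun q => lift_self _ _)
    (fun q q' hq => by
      simp only [htS] at hq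
      exact (S.equivFinOfCardEq hScard).symm.injective (Subtype.ext hq))
    (fun q q' => inner_pow_eq_of_norm_pow_eq hR hV hW hp heq (ht q) (ht q'))
  rw [Fintype.card_fin] at hfin
  -- There are `n + 1` homogeneous coordinates, so `(n + 1) + r - 1 = r + n`.
  convert hfin using 2
  omega

end FubiniStudy

theorem AreRelatives.succ_le_choose {n m : ℕ} {a b : ℝ} (ha : 0 < a) (hb : 0 < b) {s r : ℕ}
    (hab : (s : ℝ) * a = (r : ℝ) * b)
    (hrel : AreRelatives (FubiniStudy n b) (fubiniStudyMetric n b)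
      (FubiniStudy m a) (fubiniStudyMetric m a)) :
    s + 1 ≤ (r + n).choose r := by
  obtain ⟨d, Z, _, _, f, g, hd, ⟨z⟩, -, -, _, ⟨hf, -⟩, ⟨hg, hg'⟩, hfg⟩ := hrel
  obtain ⟨θ, hθ, hθ0⟩ := exists_holomorphic_curve hd z
  have hgθ := fun t (ht : MDifferentiableAt 𝓘(ℂ, ℂ) 𝓘(ℂ, EuclideanSpace ℂ (Fin d)) θ t) =>
    mfderiv_comp t (hg (θ t)) ht
  have hfθ := fun t (ht : MDifferentiableAt 𝓘(ℂ, ℂ) 𝓘(ℂ, EuclideanSpace ℂ (Fin d)) θ t) =>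
    mfderiv_comp t (hf (θ t)) ht
  refine FubiniStudy.succ_le_choose_of_curves ha hb hab (γ := f ∘ θ) (δ := g ∘ θ)
    (hθ.mono fun t ht => (hf (θ t)).comp t ht) (hθ.mono fun t ht => (hg (θ t)).comp t ht) ?_ ?_
  · intro h
    -- Injectivity of `dg` carries the nonzero velocity of `θ` over to `g ∘ θ`.
    rw [hgθ 0 hθ.self_of_nhds] at h
    exact hθ0 (hg' (θ 0) (h.trans (map_zero _).symm))
  · filter_upwards [hθ] with t ht
    rw [hfθ t ht, hgθ t ht]
    exact hfg (θ t) _ _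

theorem AreRelatives.symm {n m : ℕ}
    {M : Type} [TopologicalSpace M] [ChartedSpace (EuclideanSpace ℂ (Fin n)) M]
    {hM : ∀ x : M, TangentSpace 𝓘(ℂ, EuclideanSpace ℂ (Fin n)) x →
      TangentSpace 𝓘(ℂ, EuclideanSpace ℂ (Fin n)) x → ℂ}
    {N : Type} [TopologicalSpace N] [ChartedSpace (EuclideanSpace ℂ (Fin m)) N]
    {hN : ∀ y : N, TangentSpace 𝓘(ℂ, EuclideanSpace ℂ (Fin m)) y →
      TangentSpace 𝓘(ℂ, EuclideanSpace ℂ (Fin m)) y → ℂ}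
    (h : AreRelatives M hM N hN) : AreRelatives N hN M hM := by
  obtain ⟨d, Z, i₁, i₂, f, g, hd, hne, hT2, hsc, hman, hf, hg, hfg⟩ := h
  exact ⟨d, Z, i₁, i₂, g, f, hd, hne, hT2, hsc, hman, hg, hf, fun z u v => (hfg z u v).symm⟩

theorem mainTheorem6 (n m : ℕ) (a b : ℝ) (ha : 0 < a) (hb : 0 < b)
    (s r : ℕ) (hs : 0 < s) (hr : 0 < r) (hsr : Nat.Coprime s r)
    (hab : (s : ℝ) * a = (r : ℝ) * b)
    (hrel : AreRelatives (FubiniStudy n b) (fubiniStudyMetric n b)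
      (FubiniStudy m a) (fubiniStudyMetric m a)) :
    r + 1 ≤ Nat.choose (s + m) s ∧ s + 1 ≤ Nat.choose (r + n) r :=
  -- The first bound is the second with `(n, b, s)` and `(m, a, r)` exchanged.
  ⟨hrel.symm.succ_le_choose hb ha hab.symm, hrel.succ_le_choose ha hb hab⟩
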